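/- For $n\in\mathbb Z$ let $[n]_q=\frac{1-q^n}{1-q}$. For a rational number $x$ with regular continued fraction expansion $$x=a_0+\cfrac{1}{a_1+\cfrac{1}{a_2+\cfrac{1}{\ddots}}},\qquad a_0\in\mathbb Z,\quad a_1,a_2,\ldots\in\mathbb Z_{\ge 1}$$ (a finite expansion), let the $q$-rational $[x]_q\in\mathbb Q(q)$ be the rational function $$[x]_q=[a_0]_q+\cfrac{q^{a_0}}{[a_1]_{1/q}+\cfrac{q^{-a_1}}{[a_2]_q+\cfrac{q^{a_2}}{[a_3]_{1/q}+\cfrac{q^{-a_3}}{\ddots}}}}.$$ **Theorem 1.2.** Let $a\in\mathbb Z$ and $b\in\mathbb Z_{\ge1}$ be coprime. Then $[a/b]_q$ has no pole at $q=1$, and its second derivative there is $$\frac{d^2}{dq^2}\left[\frac ab\right]_q\Big|_{q=1}=F\left(\frac ab\right)+f\left(\frac ab\right)^2G\left(\frac ab\right)+20\sum_{n=1}^{b-1}\left\langle\frac na\right\rangle_b H\left(\frac nb\right),$$ where - $F(x)=\frac13x^3-x^2+\frac53x-1$, $G(x)=1-x$, $H(x)=x^2(1-x)$; - $f$ is Thomae's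 function: $f(x)=\frac1d$ if $x=\frac cd$ with $c\in\mathbb Z$, $d\in\mathbb Z_{\ge1}$, $\gcd(c,d)=1$, and $f(x)=0$ if $x\in\mathbb R\setminus\mathbb Q$; - $\left\langle\frac na\right\rangle_b=\frac{na^{-1}\bmod b}{b}-\frac12$, where $a^{-1}$ is the inverse of $a$ in $(\mathbb Z/b\mathbb Z)^\times$ and $m\bmod b$ is the representative of the class of $m$ in $\{0,\dots,b-1\}$. Moreover, $$20\sum_{n=1}^{b-1}\left\langle\frac na\right\rangle_b H\left(\frac nb\right)=-20\,s_{1,3}(a,b),\qquad s_{i,j}(a,b)=\sum_{n=1}^{b-1}\overline B_i\left(\frac nb\right)\overline B_j\left(\frac{an}{b}\right),$$ where $\overline B_i(x)=B_i(x-\lfloor x\rfloor)$ and $B_i$ is the $i$-th Bernoulli polynomial. -/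

import Mathlib

/-- The `q`-integer `[n]_q = (1 - q ^ n) / (1 - q)`, for `n : ℤ` and `q ≠ 1` in a field. It is used
only for the indeterminate `q` of the field of rational functions and for its inverse. -/
noncomputable def qInt {K : Type*} [Field K] (q : K) (n : ℤ) : K :=
  (1 - q ^ n) / (1 - q)

theorem den_inv_fract_lt (x : ℚ) (hx : Int.fract x ≠ 0) : (Int.fract x)⁻¹.den < x.den := by
  have h0 : 0 < Int.fract x := lt_of_le_of_ne (Int.fract_nonneg x) (Ne.symm hx)
  have h1 : Int.fract x < 1 := Int.fract_lt_one x
  have hnum : 0 < (Int.fract x).num := Rat.num_pos.mpr h0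
  have hden : (Int.fract x).den = x.den := by
    have h : Int.fract x = x - (⌊x⌋ : ℤ) := rfl
    rw [h, Rat.sub_intCast_den]
  have hlt : (Int.fract x).num < (Int.fract x).den := Rat.num_lt_denom_iff.mpr h1
  rw [Rat.den_inv_of_ne_zero hx]
  omega

/-- The `q`-deformed regular continued fraction of a rational number `x`. If
`x = a₀ + 1 / (a₁ + 1 / (a₂ + ⋯))` with `a₀ = ⌊x⌋` and `a₁, a₂, … ≥ 1`, then this is
`[a₀]_q + q ^ a₀ / ([a₁]_{1/q} + q ^ (-a₁) / ([a₂]_q + q ^ a₂ / ([a₃]_{1/q} + ⋯)))`: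
each partial quotient is the floor of the current complete quotient, and `q` is replaced by `1/q`
at each step. -/
noncomputable def qContFrac {K : Type*} [Field K] (q : K) (x : ℚ) : K :=
  if Int.fract x = 0 then qInt q ⌊x⌋
  else qInt q ⌊x⌋ + q ^ ⌊x⌋ / qContFrac q⁻¹ (Int.fract x)⁻¹
termination_by x.den
decreasing_by exact den_inv_fract_lt x ‹_›

/-- The `q`-rational number `[x]_q`, a rational function of the indeterminate `q`. -/
noncomputable def qRational (x : ℚ) : RatFunc ℚ :=
  qContFrac RatFunc.X x

/-- The function of a real variable `q` that is given by the rational function `[x]_q`. -/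
noncomputable def qRationalFun (x : ℚ) (q : ℝ) : ℝ :=
  (qRational x).eval (algebraMap ℚ ℝ) q

open Classical in
/-- Thomae's function: `1 / b` at a rational number `a / b` in lowest terms with `b > 0`, and `0` at
irrational numbers. -/
noncomputable def thomae (x : ℝ) : ℝ :=
  if h : ∃ r : ℚ, (r : ℝ) = x then 1 / (h.choose.den : ℝ) else 0

/-- `F(x) = x³/3 - x² + 5x/3 - 1`. -/
noncomputable def polyF (x : ℝ) : ℝ := x ^ 3 / 3 - x ^ 2 + 5 * x / 3 - 1

/-- `G(x) = 1 - x`. -/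
noncomputable def polyG (x : ℝ) : ℝ := 1 - x

/-- `H(x) = x² (1 - x)`. -/
noncomputable def polyH (x : ℝ) : ℝ := x ^ 2 * (1 - x)

/-- `⟨n/a⟩_b = (n a⁻¹ mod b) / b - 1/2`, where `a⁻¹` is the inverse of `a` modulo `b` and the
residue is taken in `{0, …, b - 1}`. -/
noncomputable def angleBracket (n : ℕ) (a : ℤ) (b : ℕ) : ℝ :=
  (((n : ZMod b) * (a : ZMod b)⁻¹).val : ℝ) / (b : ℝ) - 1 / 2

/-- The periodic Bernoulli function `x ↦ B_i(x - ⌊x⌋)`. -/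
noncomputable def bernoulliBar (i : ℕ) (x : ℝ) : ℝ := bernoulliFun i (Int.fract x)

/-- The generalized Dedekind sum
`s_{i,j}(a, b) = ∑_{n = 1}^{b - 1} B̄_i(n / b) B̄_j(a n / b)`. -/
noncomputable def genDedekindSum (i j : ℕ) (a : ℤ) (b : ℕ) : ℝ :=
  ∑ n ∈ Finset.Ico 1 b, bernoulliBar i ((n : ℝ) / (b : ℝ)) *
    bernoulliBar j ((a : ℝ) * (n : ℝ) / (b : ℝ))

/-! The `q`-rationals obey `[x+1]_q = 1 + q [x]_q` and `[1/y]_q = 1 / [y]_{1/q}` for `y > 1`, and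
with `[0]_q = 0` these rules determine all of them. Each rule acts on expansions to second order in
`q - 1`, so it suffices that the claimed coefficients start correctly at `0` and transform in the
same way. The first-order coefficient `(x² - x + 1 - 1/d²)/2`, with `d` the denominator of `x`, must
be carried along, since both rules mix it into the second. As inversion exchanges `q` and `1/q`, the
induction treats both parameters at once.

For the second coefficient, the shift rule is a polynomial identity together with the periodicity of
`s_{1,3}(a, b)` in `a` (`secondDerivAtOne_add_one`). The inversion rule is exactly the reciprocity
law of `s_{1,3}` (`genDedekindSum_one_three_reciprocity`, `secondDerivAtOne_inv`). The bracket sum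
with `H` equals `-s_{1,3}` by reindexing `n ↦ a n` and a parity argument
(`sum_angleBracket_mul_polyH`). -/

/-! ### Sums of periodic functions over residue systems -/

open Finset in
theorem sum_range_comp_mul_of_periodic {M : Type*} [AddCommMonoid M] {g : ℤ → M} {b : ℕ}
    (hb : 0 < b) (hg : Function.Periodic g (b : ℤ)) {a : ℤ} (hab : IsCoprime a (b : ℤ)) :
    ∑ n ∈ range b, g (a * n) = ∑ n ∈ range b, g n := by
  have hb' : (0 : ℤ) < b := by exact_mod_cast hb
  have hmod : ∀ m : ℤ, g (m % b) = g m := fun m ↦ by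
    rw [Int.emod_def, mul_comm]; exact hg.sub_int_mul_eq (m / b)
  have hcast : ∀ n : ℕ, (((a * n % b).toNat : ℕ) : ℤ) = a * n % b := fun n ↦
    Int.toNat_of_nonneg (Int.emod_nonneg _ hb'.ne')
  have hmem : ∀ n : ℕ, (a * n % b).toNat ∈ range b := fun n ↦ by
    rw [mem_range]; zify; rw [hcast]; exact Int.emod_lt_of_pos _ hb'
  have hinj : Set.InjOn (fun n : ℕ ↦ (a * n % b).toNat) (range b) := by
    intro m hm n hn hmn
    rw [coe_range, Set.mem_Iio] at hm hn
    have h : a * m % b = a * n % b := by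
      have := congrArg (Nat.cast : ℕ → ℤ) hmn
      simpa only [hcast] using this
    have h1 : (b : ℤ) ∣ a * (m - n) := by
      rw [mul_sub]; exact Int.ModEq.dvd h.symm
    have h2 : (m : ℤ) ≡ n [ZMOD b] := (Int.modEq_iff_dvd.2 (hab.symm.dvd_of_dvd_mul_left h1)).symm
    have h3 := Int.natCast_modEq_iff.1 h2
    rwa [Nat.ModEq, Nat.mod_eq_of_lt hm, Nat.mod_eq_of_lt hn] at h3
  refine sum_nbij (fun n : ℕ ↦ (a * n % b).toNat) (fun n _ ↦ hmem n) hinj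
    (surjOn_of_injOn_of_card_le _ (fun n _ ↦ hmem n) hinj le_rfl) fun n _ ↦ ?_
  rw [hcast, hmod]

theorem sum_range_add_of_periodic {M : Type*} [AddCommGroup M] {g : ℤ → M} {b : ℕ}
    (hg : Function.Periodic g (b : ℤ)) (k : ℤ) :
    ∑ n ∈ Finset.range b, g (n + k) = ∑ n ∈ Finset.range b, g n := by
  have step : ∀ k : ℤ, ∑ n ∈ Finset.range b, g (n + (k + 1)) = ∑ n ∈ Finset.range b, g (n + k) := by
    intro k
    have h := Finset.sum_range_succ (fun n : ℕ ↦ g (n + k)) b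
    rw [Finset.sum_range_succ'] at h
    have h2 : g ((b : ℤ) + k) = g ((0 : ℕ) + k) := by
      rw [add_comm, hg k]; simp
    rw [h2] at h
    rw [← add_right_cancel h]
    refine Finset.sum_congr rfl fun n _ ↦ ?_
    push_cast
    congr 1; ring
  induction k using Int.induction_on with
  | zero => simp
  | succ k ih => rw [step, ih]
  | pred k ih => rw [← ih, ← step]; simp

theorem sum_range_mul_eq_sum_sum {M : Type*} [AddCommMonoid M] (f : ℕ → M) (a b : ℕ) :
    ∑ m ∈ Finset.range (a * b), f m =
      ∑ j ∈ Finset.range a, ∑ n ∈ Finset.range b, f (b * j + n) := by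
  induction a with
  | zero => simp
  | succ a ih => rw [Finset.sum_range_succ, ← ih, add_mul, one_mul, Finset.sum_range_add, mul_comm a b]

/-- The numbers `n / b + j / a` with `0 ≤ n < b` and `0 ≤ j < a` represent all multiples of
`1 / (a b)` modulo `1`. -/
theorem sum_sum_div_add_div {a b : ℕ} (ha : 0 < a) (hb : 0 < b) (hab : Nat.Coprime a b)
    {φ : ℝ → ℝ} (hφ : Function.Periodic φ 1) :
    ∑ n ∈ Finset.range b, ∑ j ∈ Finset.range a, φ ((n : ℝ) / b + (j : ℝ) / a) =
      ∑ m ∈ Finset.range (a * b), φ ((m : ℝ) / (a * b : ℕ)) := by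
  have ha' : (a : ℝ) ≠ 0 := by positivity
  have hb' : (b : ℝ) ≠ 0 := by positivity
  -- Adding `b` to `m` shifts `j` by one, so `g` depends only on `m` modulo `b`. The left side is
  -- the sum of `g (a * n)`, and `a` is invertible modulo `b`.
  set g : ℤ → ℝ := fun m ↦ ∑ j ∈ Finset.range a, φ ((m : ℝ) / (a * b) + (j : ℝ) / a) with hgdef
  have hg : Function.Periodic g (b : ℤ) := by
    intro m
    have hper : Function.Periodic (fun i : ℤ ↦ φ ((m : ℝ) / (a * b) + (i : ℝ) / a)) (a : ℤ) := by
      intro i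
      simp only
      rw [← hφ ((m : ℝ) / (a * b) + (i : ℝ) / a)]
      congr 1
      push_cast
      field_simp
      ring
    have := sum_range_add_of_periodic hper 1
    simp only [hgdef]
    push_cast at this ⊢
    rw [← this]
    refine Finset.sum_congr rfl fun j _ ↦ ?_
    congr 1
    field_simp
    ring
  have h := sum_range_comp_mul_of_periodic hb hg (Nat.isCoprime_iff_coprime.2 hab)
  calc _ = ∑ n ∈ Finset.range b, g (a * n) := by
        refine Finset.sum_congr rfl fun n _ ↦ Finset.sum_congr rfl fun j _ ↦ ?_
        congr 2
        push_cast
        field_simp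
    _ = _ := by
        rw [h, sum_range_mul_eq_sum_sum, Finset.sum_comm]
        refine Finset.sum_congr rfl fun n _ ↦ Finset.sum_congr rfl fun j _ ↦ ?_
        congr 1
        push_cast
        field_simp
        ring

/-! ### Periodic Bernoulli functions -/

theorem bernoulliFun_three (x : ℝ) : bernoulliFun 3 x = x ^ 3 - 3 / 2 * x ^ 2 + 1 / 2 * x := by
  have h : bernoulli 3 = 0 := by
    rw [bernoulli_eq_bernoulli'_of_ne_one (by norm_num), bernoulli'_three]
  simp [bernoulliFun, Polynomial.bernoulli_def, Finset.sum_range_succ, Nat.choose, h]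
  ring

theorem bernoulliBar_periodic (i : ℕ) : Function.Periodic (bernoulliBar i) 1 := fun x ↦ by
  simp [bernoulliBar]

theorem bernoulliBar_of_mem (i : ℕ) {x : ℝ} (h0 : 0 ≤ x) (h1 : x < 1) :
    bernoulliBar i x = bernoulliFun i x := by
  rw [bernoulliBar, Int.fract_eq_self.2 ⟨h0, h1⟩]

/-- Both sides are unchanged when `t` moves by `1 / a`, so `t` may be replaced by a point of `[0,
1/a)`. All arguments then lie in `[0, 1)`, where the multiplication formula for Bernoulli
polynomials applies. -/
theorem bernoulliBar_mul (i : ℕ) {a : ℕ} (ha : a ≠ 0) (t : ℝ) :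
    bernoulliBar i (a * t) =
      a ^ i / a * ∑ j ∈ Finset.range a, bernoulliBar i (t + (j : ℝ) / a) := by
  have ha' : (0 : ℝ) < a := by positivity
  set θ := Int.fract (a * t) with hθ
  have hθ0 : 0 ≤ θ := Int.fract_nonneg _
  have hθ1 : θ < 1 := Int.fract_lt_one _
  have hper : Function.Periodic (fun i' : ℤ ↦ bernoulliBar i (θ / a + (i' : ℝ) / a)) (a : ℤ) := by
    intro m
    simp only
    rw [← bernoulliBar_periodic i (θ / a + (m : ℝ) / a)]
    congr 1
    push_cast
    field_simp
    ring
  have h1 : ∑ j ∈ Finset.range a, bernoulliBar i (t + (j : ℝ) / a) =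
      ∑ j ∈ Finset.range a, bernoulliBar i (θ / a + (j : ℝ) / a) := by
    have h := sum_range_add_of_periodic hper ⌊a * t⌋
    push_cast at h
    rw [← h]
    refine Finset.sum_congr rfl fun j _ ↦ ?_
    congr 1
    field_simp
    have := Int.fract_add_floor (a * t)
    rw [← hθ] at this
    rw [mul_comm t]
    linarith
  have h2 : ∀ j ∈ Finset.range a, bernoulliBar i (θ / a + (j : ℝ) / a) =
      bernoulliFun i (θ / a + (j : ℝ) / a) := by
    intro j hj
    have hj' : (j : ℝ) + 1 ≤ a := by exact_mod_cast Finset.mem_range.1 hj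
    refine bernoulliBar_of_mem i (by positivity) ?_
    rw [← add_div, div_lt_one ha']
    linarith
  rw [h1, Finset.sum_congr rfl h2]
  have h3 := bernoulliFun_mul i ha (θ / a)
  rw [mul_div_cancel₀ _ ha'.ne'] at h3
  rw [bernoulliBar, ← hθ, h3]

/-! ### The sums `s_{1,3}` and their reciprocity law -/

/-- The term `n = 0` can be added because `B̄_3(0) = 0`, although the linear factor there is `-1/2`.
-/
theorem genDedekindSum_one_three (a : ℤ) (b : ℕ) :
    genDedekindSum 1 3 a b = ∑ n ∈ Finset.range b,
      ((n : ℝ) / b - 1 / 2) * bernoulliBar 3 (a * ((n : ℝ) / b)) := by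
  rcases Nat.eq_zero_or_pos b with rfl | hb
  · simp [genDedekindSum]
  have hb' : (0 : ℝ) < b := by positivity
  have h0 : bernoulliBar 3 0 = 0 := by simp [bernoulliBar, bernoulliFun_three]
  rw [genDedekindSum, Finset.range_eq_Ico, Finset.sum_eq_sum_Ico_succ_bot hb]
  simp only [Nat.cast_zero, zero_div, mul_zero, h0, zero_add]
  refine Finset.sum_congr rfl fun n hn ↦ ?_
  have hn' : (n : ℝ) < b := by exact_mod_cast (Finset.mem_Ico.1 hn).2
  rw [bernoulliBar_of_mem 1 (by positivity) ((div_lt_one hb').2 hn'), bernoulliFun_one, mul_div_assoc]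

theorem genDedekindSum_one_three_add (a : ℤ) (b : ℕ) :
    genDedekindSum 1 3 (a + b) b = genDedekindSum 1 3 a b := by
  refine Finset.sum_congr rfl fun n hn ↦ ?_
  have hb' : (b : ℝ) ≠ 0 := by
    have := Finset.mem_Ico.1 hn
    exact_mod_cast (by omega : b ≠ 0)
  have : ((a + b : ℤ) : ℝ) * n / b = a * n / b + (n : ℤ) := by
    push_cast; field_simp
  simp only [this, bernoulliBar, Int.fract_add_intCast]

theorem sum_range_quartic (n : ℕ) (hn : 0 < n) (c₀ c₁ c₂ c₃ c₄ : ℝ) :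
    ∑ k ∈ Finset.range n, (c₀ + c₁ * ((k : ℝ) / n) + c₂ * ((k : ℝ) / n) ^ 2
      + c₃ * ((k : ℝ) / n) ^ 3 + c₄ * ((k : ℝ) / n) ^ 4) =
    c₀ * n + c₁ * ((n - 1) / 2) + c₂ * ((n - 1) * (2 * n - 1) / (6 * n))
      + c₃ * ((n - 1) ^ 2 / (4 * n))
      + c₄ * ((n - 1) * (2 * n - 1) * (3 * n ^ 2 - 3 * n - 1) / (30 * n ^ 3)) := by
  -- The induction needs the upper limit `m` to vary independently of the denominator `n`.
  have key : ∀ m : ℕ, ∑ k ∈ Finset.range m, (c₀ + c₁ * ((k : ℝ) / n) + c₂ * ((k : ℝ) / n) ^ 2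
      + c₃ * ((k : ℝ) / n) ^ 3 + c₄ * ((k : ℝ) / n) ^ 4) =
      c₀ * m + c₁ * (m * (m - 1) / (2 * n)) + c₂ * (m * (m - 1) * (2 * m - 1) / (6 * n ^ 2))
      + c₃ * (m ^ 2 * (m - 1) ^ 2 / (4 * n ^ 3))
      + c₄ * (m * (m - 1) * (2 * m - 1) * (3 * m ^ 2 - 3 * m - 1) / (30 * n ^ 4)) := by
    intro m
    induction m with
    | zero => simp
    | succ m ih =>
      rw [Finset.sum_range_succ, ih]
      push_cast
      field_simp
      ring
  rw [key]
  field_simp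

/-- This drives reciprocity: the symmetrized summand splits into a function of `x + y` modulo `1`
and a polynomial, both of which can be summed in closed form. -/
theorem bernoulliBar_three_add {x y : ℝ} (hx0 : 0 ≤ x) (hx1 : x < 1) (hy0 : 0 ≤ y) (hy1 : y < 1) :
    ((x - 1 / 2) + (y - 1 / 2)) * bernoulliBar 3 (x + y) =
      3 / 4 * (Int.fract (x + y)) ^ 2 * (Int.fract (x + y) - 1) ^ 2
        + (x + y) * (x + y - 1) ^ 2 * (x + y - 2) / 4 := by
  rw [bernoulliBar, bernoulliFun_three]
  rcases lt_or_ge (x + y) 1 with h | h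
  · rw [Int.fract_eq_self.2 ⟨by positivity, h⟩]
    ring
  · have : Int.fract (x + y) = x + y - 1 := by
      rw [← Int.fract_sub_one, Int.fract_eq_self.2 ⟨by linarith, by linarith⟩]
    rw [this]
    ring

/-- The reciprocity law of the generalized Dedekind sums `s_{1,3}`. -/
theorem genDedekindSum_one_three_reciprocity {a b : ℕ} (ha : 0 < a) (hb : 0 < b)
    (hab : Nat.Coprime a b) :
    genDedekindSum 1 3 a b / a ^ 2 + genDedekindSum 1 3 b a / b ^ 2 =
      (5 * a ^ 2 * b ^ 2 - a ^ 4 - b ^ 4 - 3) / (120 * a ^ 3 * b ^ 3 : ℝ) := by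
  have ha' : (0 : ℝ) < a := by positivity
  have hb' : (0 : ℝ) < b := by positivity
  -- The multiplication formula contributes `a ^ 3 / a = a ^ 2`, so both normalized sums run over
  -- the same grid of pairs `(n, j)`.
  have e1 : genDedekindSum 1 3 a b / a ^ 2 = ∑ n ∈ Finset.range b, ∑ j ∈ Finset.range a,
      ((n : ℝ) / b - 1 / 2) * bernoulliBar 3 ((n : ℝ) / b + (j : ℝ) / a) := by
    rw [genDedekindSum_one_three, Finset.sum_div]
    refine Finset.sum_congr rfl fun n _ ↦ ?_
    rw [← Finset.mul_sum, Int.cast_natCast, bernoulliBar_mul 3 ha.ne']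
    norm_num
    field_simp
  have e2 : genDedekindSum 1 3 b a / b ^ 2 = ∑ n ∈ Finset.range b, ∑ j ∈ Finset.range a,
      ((j : ℝ) / a - 1 / 2) * bernoulliBar 3 ((n : ℝ) / b + (j : ℝ) / a) := by
    rw [genDedekindSum_one_three, Finset.sum_div, Finset.sum_comm]
    refine Finset.sum_congr rfl fun n _ ↦ ?_
    rw [← Finset.mul_sum, Int.cast_natCast, bernoulliBar_mul 3 hb.ne']
    simp_rw [add_comm _ ((n : ℝ) / a)]
    norm_num
    field_simp
  have hφ : Function.Periodic (fun z : ℝ ↦ 3 / 4 * (Int.fract z) ^ 2 * (Int.fract z - 1) ^ 2) 1 :=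
    fun z ↦ by simp
  have e3 := sum_sum_div_add_div ha hb hab hφ
  have e4 : ∑ m ∈ Finset.range (a * b), 3 / 4 * (Int.fract ((m : ℝ) / (a * b : ℕ))) ^ 2
      * (Int.fract ((m : ℝ) / (a * b : ℕ)) - 1) ^ 2 =
      ((a * b : ℝ) ^ 4 - 1) / (40 * (a * b : ℝ) ^ 3) := by
    have hab' : 0 < a * b := Nat.mul_pos ha hb
    have h := sum_range_quartic (a * b) hab' 0 0 (3 / 4) (-3 / 2) (3 / 4)
    have e : ∀ m ∈ Finset.range (a * b), 3 / 4 * (Int.fract ((m : ℝ) / (a * b : ℕ))) ^ 2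
        * (Int.fract ((m : ℝ) / (a * b : ℕ)) - 1) ^ 2 =
        0 + 0 * ((m : ℝ) / (a * b : ℕ)) + 3 / 4 * ((m : ℝ) / (a * b : ℕ)) ^ 2
          + (-3 / 2) * ((m : ℝ) / (a * b : ℕ)) ^ 3 + 3 / 4 * ((m : ℝ) / (a * b : ℕ)) ^ 4 := by
      intro m hm
      have hm' : (m : ℝ) < (a * b : ℕ) := by exact_mod_cast Finset.mem_range.1 hm
      rw [Int.fract_eq_self.2 ⟨by positivity, (div_lt_one (by positivity)).2 hm'⟩]
      ring
    rw [Finset.sum_congr rfl e, h]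
    push_cast
    field_simp
    ring
  rw [e1, e2, ← Finset.sum_add_distrib]
  simp_rw [← Finset.sum_add_distrib, ← add_mul]
  have e5 : ∀ n ∈ Finset.range b, ∀ j ∈ Finset.range a,
    ((n : ℝ) / b - 1 / 2 + ((j : ℝ) / a - 1 / 2)) * bernoulliBar 3 ((n : ℝ) / b + (j : ℝ) / a) =
     3 / 4 * (Int.fract ((n : ℝ) / b + (j : ℝ) / a)) ^ 2 * (Int.fract ((n : ℝ) / b + (j : ℝ) / a) - 1) ^ 2
        + ((n : ℝ) / b + (j : ℝ) / a) * ((n : ℝ) / b + (j : ℝ) / a - 1) ^ 2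
          * ((n : ℝ) / b + (j : ℝ) / a - 2) / 4 := by
    intro n hn j hj
    have hn' : (n : ℝ) < b := by exact_mod_cast Finset.mem_range.1 hn
    have hj' : (j : ℝ) < a := by exact_mod_cast Finset.mem_range.1 hj
    exact bernoulliBar_three_add (by positivity) ((div_lt_one hb').2 hn') (by positivity)
      ((div_lt_one ha').2 hj')
  rw [Finset.sum_congr rfl fun n hn ↦ Finset.sum_congr rfl (e5 n hn)]
  simp_rw [Finset.sum_add_distrib]
  rw [e3, e4]
  have e6 : ∀ x : ℝ, ∑ j ∈ Finset.range a, (x + (j : ℝ) / a) * (x + (j : ℝ) / a - 1) ^ 2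
          * (x + (j : ℝ) / a - 2) / 4 =
      (-1 / 2 * ((a - 1) / 2) + 5 / 4 * ((a - 1) * (2 * a - 1) / (6 * a))
        - ((a - 1) ^ 2 / (4 * a))
        + 1 / 4 * ((a - 1) * (2 * a - 1) * (3 * a ^ 2 - 3 * a - 1) / (30 * a ^ 3)))
      + (-1 / 2 * a + 5 / 2 * ((a - 1) / 2) - 3 * ((a - 1) * (2 * a - 1) / (6 * a))
        + (a - 1) ^ 2 / (4 * a)) * x
      + (5 / 4 * a - 3 * ((a - 1) / 2) + 3 / 2 * ((a - 1) * (2 * a - 1) / (6 * a))) * x ^ 2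
      + (-a + (a - 1) / 2) * x ^ 3 + a / 4 * x ^ 4 := by
    intro x
    -- The coefficients are the Taylor coefficients at `x` of `z (z - 1)² (z - 2) / 4`.
    have h := sum_range_quartic a ha ((x ^ 4 - 4 * x ^ 3 + 5 * x ^ 2 - 2 * x) / 4)
      ((4 * x ^ 3 - 12 * x ^ 2 + 10 * x - 2) / 4) ((6 * x ^ 2 - 12 * x + 5) / 4) (x - 1) (1 / 4)
    calc _ = _ := Finset.sum_congr rfl fun j _ ↦ by ring
      _ = _ := h
      _ = _ := by ring
  simp_rw [e6]
  rw [sum_range_quartic b hb]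
  field_simp
  ring

/-! ### The bracket sum as a Dedekind sum -/

/-- The summand is odd under `n ↦ -n` modulo `b`. At `n = 0`, where the linear factor is not odd,
the quadratic factor vanishes. -/
theorem sum_sub_half_mul_fract_sq_sub_fract (a : ℤ) {b : ℕ} (hb : 0 < b) :
    ∑ n ∈ Finset.range b, ((n : ℝ) / b - 1 / 2) *
      (Int.fract (a * ((n : ℝ) / b)) ^ 2 - Int.fract (a * ((n : ℝ) / b))) = 0 := by
  have hb' : (0 : ℝ) < b := by positivity
  set g : ℤ → ℝ := fun m ↦ (Int.fract ((m : ℝ) / b) - 1 / 2) *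
    (Int.fract (a * ((m : ℝ) / b)) ^ 2 - Int.fract (a * ((m : ℝ) / b))) with hg
  have hper : Function.Periodic g b := by
    intro m
    have e1 : ((m + b : ℤ) : ℝ) / b = (m : ℝ) / b + (1 : ℤ) := by push_cast; field_simp
    have e2 : (a : ℝ) * ((m : ℝ) / b + (1 : ℤ)) = a * ((m : ℝ) / b) + (a : ℤ) := by
      push_cast; ring
    simp only [hg, e1, e2, Int.fract_add_intCast]
  have hodd : ∀ m, g (-1 * m) = -g m := by
    intro m
    have e1 : ((-1 * m : ℤ) : ℝ) / b = -((m : ℝ) / b) := by push_cast; ring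
    simp only [hg, e1, mul_neg]
    rcases eq_or_ne (Int.fract ((m : ℝ) / b)) 0 with h | h
    · obtain ⟨k, hk⟩ := Int.fract_eq_zero_iff.1 h
      have e2 : (a : ℝ) * k = ((a * k : ℤ) : ℝ) := by push_cast; ring
      rw [← hk, e2]
      have e3 : -((a * k : ℤ) : ℝ) = ((-(a * k) : ℤ) : ℝ) := by push_cast; ring
      simp only [e3, Int.fract_intCast]
      ring
    · rw [Int.fract_neg h]
      rcases eq_or_ne (Int.fract (a * ((m : ℝ) / b))) 0 with h' | h'
      · rw [Int.fract_neg_eq_zero.2 h', h']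
        simp
      · rw [Int.fract_neg h']
        ring
  have h1 := sum_range_comp_mul_of_periodic hb hper (a := -1) isCoprime_one_left.neg_left
  simp only [hodd, Finset.sum_neg_distrib] at h1
  have h2 : ∑ n ∈ Finset.range b, g n = 0 := by linarith
  rw [← h2]
  refine Finset.sum_congr rfl fun n hn ↦ ?_
  have hn' : (n : ℝ) < b := by exact_mod_cast Finset.mem_range.1 hn
  simp only [hg, Int.cast_natCast]
  rw [Int.fract_eq_self.2 ⟨by positivity, (div_lt_one hb').2 hn'⟩]

theorem sum_angleBracket_mul_polyH (a : ℤ) {b : ℕ} (hb : 0 < b) (hab : IsCoprime a (b : ℤ)) :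
    ∑ n ∈ Finset.Ico 1 b, angleBracket n a b * polyH ((n : ℝ) / b) =
      -genDedekindSum 1 3 a b := by
  have hb' : (0 : ℝ) < b := by positivity
  have : NeZero b := ⟨hb.ne'⟩
  set g : ℤ → ℝ := fun m ↦ ((((m : ZMod b) * (a : ZMod b)⁻¹).val : ℝ) / b - 1 / 2) *
    polyH (Int.fract ((m : ℝ) / b)) with hg
  have hper : Function.Periodic g b := by
    intro m
    have e1 : ((m + b : ℤ) : ℝ) / b = (m : ℝ) / b + (1 : ℤ) := by push_cast; field_simp
    have e2 : ((m + b : ℤ) : ZMod b) = (m : ZMod b) := by push_cast; simp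
    simp only [hg, e1, e2, Int.fract_add_intCast]
  have h1 : ∑ n ∈ Finset.Ico 1 b, angleBracket n a b * polyH ((n : ℝ) / b) =
      ∑ n ∈ Finset.range b, g n := by
    rw [Finset.range_eq_Ico, Finset.sum_eq_sum_Ico_succ_bot hb (fun n : ℕ ↦ g n)]
    have h0 : g (0 : ℕ) = 0 := by simp [hg, polyH]
    rw [h0, zero_add]
    refine Finset.sum_congr rfl fun n hn ↦ ?_
    have hn' : (n : ℝ) < b := by exact_mod_cast (Finset.mem_Ico.1 hn).2
    simp only [hg, Int.cast_natCast, angleBracket]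
    rw [Int.fract_eq_self.2 ⟨by positivity, (div_lt_one hb').2 hn'⟩]
  have hunit : (a : ZMod b) * (a : ZMod b)⁻¹ = 1 := by
    refine ZMod.mul_inv_of_unit _ ?_
    exact (ZMod.coe_int_isUnit_iff_isCoprime a b).2 hab.symm
  -- After `n ↦ a n` the bracket becomes `n / b - 1/2`. Since `H + B_3 = -(x² - x)/2`, the
  -- discrepancy is `-1/2` times the vanishing odd sum.
  rw [h1, ← sum_range_comp_mul_of_periodic hb hper hab, genDedekindSum_one_three,
    ← Finset.sum_neg_distrib, ← sub_eq_zero, ← Finset.sum_sub_distrib,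
    ← mul_zero (-1 / 2 : ℝ), ← sum_sub_half_mul_fract_sq_sub_fract a hb, Finset.mul_sum]
  refine Finset.sum_congr rfl fun n hn ↦ ?_
  have e1 : (((a * n : ℤ) : ZMod b) * (a : ZMod b)⁻¹).val = n := by
    push_cast
    rw [mul_right_comm, hunit, one_mul, ZMod.val_cast_of_lt (Finset.mem_range.1 hn)]
  have e2 : ((a * n : ℤ) : ℝ) / b = a * ((n : ℝ) / b) := by push_cast; ring
  simp only [hg]
  rw [e1, e2, bernoulliBar, bernoulliFun_three, polyH]
  ring

/-! ### The local ring at `1` and second-order jets -/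

open Polynomial in
/-- The ring of rational functions without a pole at `1`. -/
noncomputable def regularAtOne : Subring (RatFunc ℚ) where
  carrier := {r | r.denom.eval 1 ≠ 0}
  mul_mem' {r s} hr hs h := mul_ne_zero hr hs <| by
    rw [← eval_mul]; exact eval_eq_zero_of_dvd_of_eval_eq_zero (RatFunc.denom_mul_dvd r s) h
  one_mem' := by simp
  add_mem' {r s} hr hs h := mul_ne_zero hr hs <| by
    rw [← eval_mul]; exact eval_eq_zero_of_dvd_of_eval_eq_zero (RatFunc.denom_add_dvd r s) h
  zero_mem' := by simp
  neg_mem' {r} hr h := hr <| by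
    have hd := RatFunc.denom_mul_dvd (RatFunc.C (-1)) r
    rw [RatFunc.denom_C, one_mul] at hd
    refine eval_eq_zero_of_dvd_of_eval_eq_zero hd ?_
    rwa [map_neg, map_one, neg_one_mul]

theorem mem_regularAtOne {r : RatFunc ℚ} : r ∈ regularAtOne ↔ r.denom.eval 1 ≠ 0 := Iff.rfl

theorem div_mem_regularAtOne (p q : Polynomial ℚ) (hq : q.eval 1 ≠ 0) :
    algebraMap _ (RatFunc ℚ) p / algebraMap _ (RatFunc ℚ) q ∈ regularAtOne := fun h ↦
  hq (Polynomial.eval_eq_zero_of_dvd_of_eval_eq_zero (RatFunc.denom_div_dvd p q) h)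

theorem ratCast_mem_regularAtOne (c : ℚ) : (c : RatFunc ℚ) ∈ regularAtOne := by
  have := div_mem_regularAtOne (Polynomial.C c) 1 (by simp)
  simpa using this

theorem X_mem_regularAtOne : RatFunc.X ∈ regularAtOne := by
  simp [mem_regularAtOne]

theorem inv_mem_regularAtOne {c : ℚ} (hc : c ≠ 0) {e : RatFunc ℚ} (he : e ∈ regularAtOne) :
    ((c : RatFunc ℚ) + (RatFunc.X - 1) * e)⁻¹ ∈ regularAtOne := by
  have hd : algebraMap _ (RatFunc ℚ) e.denom ≠ 0 := RatFunc.algebraMap_ne_zero e.denom_ne_zero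
  have h := div_mem_regularAtOne e.denom
    (Polynomial.C c * e.denom + (Polynomial.X - 1) * e.num) (by simpa [hc] using mem_regularAtOne.1 he)
  convert h using 1
  nth_rw 1 [← RatFunc.num_div_denom e]
  simp only [map_add, map_mul, map_sub, map_one, RatFunc.algebraMap_X, RatFunc.algebraMap_C]
  rw [show (RatFunc.C c : RatFunc ℚ) = (c : RatFunc ℚ) from by simp]
  rw [inv_eq_iff_eq_inv, inv_div]
  field_simp

theorem ratCast_add_mul_ne_zero {c : ℚ} (hc : c ≠ 0) {e : RatFunc ℚ} (he : e ∈ regularAtOne) :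
    (c : RatFunc ℚ) + (RatFunc.X - 1) * e ≠ 0 := by
  intro h
  have hd : algebraMap _ (RatFunc ℚ) e.denom ≠ 0 := RatFunc.algebraMap_ne_zero e.denom_ne_zero
  have h1 : algebraMap _ (RatFunc ℚ)
      (Polynomial.C c * e.denom + (Polynomial.X - 1) * e.num) = 0 := by
    simp only [map_add, map_mul, map_sub, map_one, RatFunc.algebraMap_X, RatFunc.algebraMap_C]
    rw [show (RatFunc.C c : RatFunc ℚ) = (c : RatFunc ℚ) from by simp]
    rw [← RatFunc.num_div_denom e] at h
    field_simp at h
    linear_combination h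
  have h2 := congrArg (Polynomial.eval 1) ((map_eq_zero_iff _ (RatFunc.algebraMap_injective ℚ)).1 h1)
  simp [hc] at h2
  exact he h2

/-- `q` is a unit at `1` and takes the value `1` there. -/
structure IsParameterAtOne (q : RatFunc ℚ) : Prop where
  mem : q ∈ regularAtOne
  inv_mem : q⁻¹ ∈ regularAtOne
  ne_one : q ≠ 1
  ne_zero : q ≠ 0
  sub_one : ∃ u ∈ regularAtOne, q - 1 = (RatFunc.X - 1) * u

theorem IsParameterAtOne.inv {q : RatFunc ℚ} (h : IsParameterAtOne q) : IsParameterAtOne q⁻¹ where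
  mem := h.inv_mem
  inv_mem := by simpa using h.mem
  ne_one := by simpa using h.ne_one
  ne_zero := by simpa using h.ne_zero
  sub_one := by
    obtain ⟨u, hu, hq⟩ := h.sub_one
    refine ⟨-u * q⁻¹, mul_mem (neg_mem hu) h.inv_mem, ?_⟩
    have := h.ne_zero
    field_simp
    linear_combination -hq

theorem isParameterAtOne_X : IsParameterAtOne RatFunc.X where
  mem := X_mem_regularAtOne
  inv_mem := by simpa using inv_mem_regularAtOne one_ne_zero (one_mem regularAtOne)
  ne_one h := by
    have := congrArg (fun r ↦ r.num.eval 0) h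
    simp at this
  ne_zero := RatFunc.X_ne_zero
  sub_one := ⟨1, one_mem _, by simp⟩

/-- `r = c₀ + c₁ (q - 1) + c₂ (q - 1) ^ 2 + O((q - 1) ^ 3)`. -/
def HasJet (q r : RatFunc ℚ) (c₀ c₁ c₂ : ℚ) : Prop :=
  ∃ e ∈ regularAtOne,
    r = (c₀ : RatFunc ℚ) + c₁ * (q - 1) + c₂ * (q - 1) ^ 2 + (q - 1) ^ 3 * e

theorem HasJet.one_add_mul {q r : RatFunc ℚ} (hq : IsParameterAtOne q) {c₀ c₁ c₂ : ℚ}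
    (h : HasJet q r c₀ c₁ c₂) : HasJet q (1 + q * r) (c₀ + 1) (c₁ + c₀) (c₂ + c₁) := by
  obtain ⟨e, he, rfl⟩ := h
  refine ⟨(c₂ : RatFunc ℚ) + q * e,
    add_mem (ratCast_mem_regularAtOne c₂) (mul_mem hq.mem he), ?_⟩
  push_cast
  ring

theorem HasJet.of_one_add_mul {q r : RatFunc ℚ} (hq : IsParameterAtOne q) {c₀ c₁ c₂ : ℚ}
    (h : HasJet q (1 + q * r) (c₀ + 1) (c₁ + c₀) (c₂ + c₁)) : HasJet q r c₀ c₁ c₂ := by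
  obtain ⟨e, he, h⟩ := h
  refine ⟨q⁻¹ * (e - (c₂ : RatFunc ℚ)),
    mul_mem hq.inv_mem (sub_mem he (ratCast_mem_regularAtOne c₂)), ?_⟩
  push_cast at h
  have := hq.ne_zero
  field_simp
  linear_combination h

/-- With `h = q - 1` one has `q⁻¹ - 1 = -h + h² + O(h³)`, so `r = c₀ - c₁ h + (c₁ + c₂) h² + O(h³)`,
and this series is then inverted. -/
theorem HasJet.inv {q r : RatFunc ℚ} (hq : IsParameterAtOne q) {c₀ c₁ c₂ : ℚ} (hc : c₀ ≠ 0)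
    (h : HasJet q⁻¹ r c₀ c₁ c₂) :
    HasJet q r⁻¹ (1 / c₀) (c₁ / c₀ ^ 2) (c₁ ^ 2 / c₀ ^ 3 - (c₁ + c₂) / c₀ ^ 2) := by
  obtain ⟨e, he, hr⟩ := h
  obtain ⟨u, hu, hqu⟩ := hq.sub_one
  have hq0 := hq.ne_zero
  have hh : q - 1 ∈ regularAtOne := sub_mem hq.mem (one_mem _)
  have hc' : (c₀ : RatFunc ℚ) ≠ 0 := by exact_mod_cast hc
  set p := q⁻¹ with hp
  have hpm : p ∈ regularAtOne := hq.inv_mem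
  have hC := ratCast_mem_regularAtOne
  -- Exact remainder, from `p - 1 = -h + h² - h³ p`, `(p - 1)² = h² - h³ p (p + 1)` and `(p - 1)³ =
  -- -h³ p³`, where `h = q - 1`.
  set E : RatFunc ℚ := -c₁ * p - c₂ * p * (p + 1) - p ^ 3 * e with hE
  have hEm : E ∈ regularAtOne :=
    sub_mem (sub_mem (mul_mem (neg_mem (hC _)) hpm) (mul_mem (mul_mem (hC _) hpm)
      (add_mem hpm (one_mem _)))) (mul_mem (pow_mem hpm _) he)
  have hr' : r = c₀ - c₁ * (q - 1) + (c₁ + c₂) * (q - 1) ^ 2 + (q - 1) ^ 3 * E := by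
    have hpeq : p = 1 / q := by rw [hp, one_div]
    rw [hr, hE, hpeq]
    field_simp
    ring
  -- Writing `r = c₀ + (X - 1) W` with `c₀ ≠ 0` shows that `r` is a unit of the local ring.
  set W : RatFunc ℚ := u * (-(c₁ : RatFunc ℚ) + ((c₁ : RatFunc ℚ) + c₂) * (q - 1) + (q - 1) ^ 2 * E)
    with hW
  have hWm : W ∈ regularAtOne := mul_mem hu (add_mem (add_mem (neg_mem (hC _))
      (mul_mem (add_mem (hC _) (hC _)) hh)) (mul_mem (pow_mem hh _) hEm))
  have hrW : r = (c₀ : RatFunc ℚ) + (RatFunc.X - 1) * W := by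
    rw [hW, ← mul_assoc, ← hqu, hr']; ring
  have hrm : r⁻¹ ∈ regularAtOne := hrW ▸ inv_mem_regularAtOne hc hWm
  have hr0 : r ≠ 0 := hrW ▸ ratCast_add_mul_ne_zero hc hWm
  set d₁ : ℚ := c₁ / c₀ ^ 2 with hd₁
  set d₂ : ℚ := c₁ ^ 2 / c₀ ^ 3 - (c₁ + c₂) / c₀ ^ 2 with hd₂
  refine ⟨-(r⁻¹ * (E * (((1 / c₀ : ℚ) : RatFunc ℚ) + d₁ * (q - 1) + d₂ * (q - 1) ^ 2)
    + (-c₁ * d₂ + (c₁ + c₂) * d₁) + (c₁ + c₂) * d₂ * (q - 1))), ?_, ?_⟩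
  · exact neg_mem (mul_mem hrm (add_mem (add_mem (mul_mem hEm (add_mem (add_mem (hC _)
      (mul_mem (hC _) hh)) (mul_mem (hC _) (pow_mem hh _)))) (add_mem (mul_mem (neg_mem (hC _)) (hC _))
      (mul_mem (add_mem (hC _) (hC _)) (hC _)))) (mul_mem (mul_mem (add_mem (hC _) (hC _)) (hC _)) hh)))
  · refine mul_left_cancel₀ hr0 ?_
    have h2 : ∀ Z : RatFunc ℚ, r * (r⁻¹ * Z) = Z := fun Z ↦ mul_inv_cancel_left₀ hr0 Z
    have h3 : ∀ S Z : RatFunc ℚ, r * (S + (q - 1) ^ 3 * -(r⁻¹ * Z)) = r * S - (q - 1) ^ 3 * Z := by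
      intro S Z; linear_combination -(q - 1) ^ 3 * h2 Z
    rw [mul_inv_cancel₀ hr0, h3, hr', hd₁, hd₂]
    push_cast
    field_simp
    ring

/-! ### Functional equations of the `q`-continued fraction -/

theorem qInt_add_one {q : RatFunc ℚ} (h1 : q ≠ 1) (h0 : q ≠ 0) (n : ℤ) :
    qInt q (n + 1) = 1 + q * qInt q n := by
  have : 1 - q ≠ 0 := sub_ne_zero.2 h1.symm
  rw [qInt, qInt, zpow_add_one₀ h0]
  field_simp
  ring

theorem qContFrac_add_one {q : RatFunc ℚ} (h1 : q ≠ 1) (h0 : q ≠ 0) (x : ℚ) :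
    qContFrac q (x + 1) = 1 + q * qContFrac q x := by
  rw [qContFrac, qContFrac.eq_1 q x, Int.fract_add_one, Int.floor_add_one, qInt_add_one h1 h0,
    zpow_add_one₀ h0]
  split_ifs
  · rfl
  · ring

theorem qContFrac_zero (q : RatFunc ℚ) : qContFrac q 0 = 0 := by
  rw [qContFrac]; simp [qInt]

theorem qContFrac_inv (q : RatFunc ℚ) {y : ℚ} (hy : 1 < y) :
    qContFrac q y⁻¹ = (qContFrac q⁻¹ y)⁻¹ := by
  have h0 : 0 < y := by linarith
  have h1 : y⁻¹ < 1 := inv_lt_one_of_one_lt₀ hy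
  have hf : Int.fract y⁻¹ = y⁻¹ := Int.fract_eq_self.2 ⟨by positivity, h1⟩
  have hfl : ⌊y⁻¹⌋ = 0 := Int.floor_eq_zero_iff.2 ⟨by positivity, h1⟩
  rw [qContFrac, hf, hfl, if_neg (by positivity), inv_inv]
  simp [qInt]

/-! ### The jet of `[x]_q` by induction on the denominator -/

/-- The second derivative of `[x]_q` at `q = 1`, in terms of a generalized Dedekind sum. -/
noncomputable def secondDerivAtOne (x : ℚ) : ℝ :=
  polyF x + (1 / x.den : ℝ) ^ 2 * polyG x - 20 * genDedekindSum 1 3 x.num x.den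

/-- The expansion of `[x]_q` to second order in `q - 1`, for all local parameters `q - 1` at `1`. -/
def QRationalJet (x : ℚ) : Prop :=
  ∃ c : ℚ, 2 * (c : ℝ) = secondDerivAtOne x ∧ ∀ q, IsParameterAtOne q →
    HasJet q (qContFrac q x) x ((x ^ 2 - x + 1 - 1 / x.den ^ 2) / 2) c

theorem secondDerivAtOne_add_one (x : ℚ) :
    secondDerivAtOne (x + 1) = secondDerivAtOne x + (x ^ 2 - x + 1 - 1 / x.den ^ 2) := by
  have hd : (x + 1).den = x.den := Rat.add_intCast_den x 1
  have hn : (x + 1).num = x.num + x.den := by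
    have h1 := Rat.num_div_den (x + 1)
    have h2 := Rat.num_div_den x
    have hx : (x.den : ℚ) ≠ 0 := by exact_mod_cast x.den_ne_zero
    rw [hd, div_eq_iff hx] at h1
    rw [div_eq_iff hx] at h2
    have h3 : ((x + 1).num : ℚ) = x.num + x.den := by linear_combination h1 - h2
    exact_mod_cast h3
  rw [secondDerivAtOne, secondDerivAtOne, hd, hn, genDedekindSum_one_three_add, polyF, polyG, polyF,
    polyG]
  push_cast
  ring

theorem qRationalJet_add_one_iff (x : ℚ) : QRationalJet (x + 1) ↔ QRationalJet x := by
  have hd : (x + 1).den = x.den := Rat.add_intCast_den x 1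
  have e : ((x + 1) ^ 2 - (x + 1) + 1 - 1 / ((x + 1).den : ℚ) ^ 2) / 2 =
    (x ^ 2 - x + 1 - 1 / (x.den : ℚ) ^ 2) / 2 + x := by rw [hd]; ring
  constructor
  · rintro ⟨c, hc, h⟩
    refine ⟨c - (x ^ 2 - x + 1 - 1 / x.den ^ 2) / 2, ?_, fun q hq ↦ HasJet.of_one_add_mul hq ?_⟩
    · rw [secondDerivAtOne_add_one] at hc
      push_cast
      linarith
    · rw [← qContFrac_add_one hq.ne_one hq.ne_zero, ← e, sub_add_cancel]
      exact h q hq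
  · rintro ⟨c, hc, h⟩
    refine ⟨c + (x ^ 2 - x + 1 - 1 / x.den ^ 2) / 2, ?_, fun q hq ↦ ?_⟩
    · rw [secondDerivAtOne_add_one]
      push_cast
      linarith
    · rw [qContFrac_add_one hq.ne_one hq.ne_zero, e]
      exact (h q hq).one_add_mul hq

theorem qRationalJet_zero : QRationalJet 0 :=
  ⟨0, by simp [secondDerivAtOne, polyF, polyG, genDedekindSum], fun q _ ↦
    ⟨0, zero_mem _, by simp [qContFrac_zero]⟩⟩

theorem den_inv_eq_mul_den {y : ℚ} (hy : 0 < y) : ((y⁻¹).den : ℚ) = y * y.den := by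
  rw [Rat.den_inv_of_ne_zero hy.ne', Rat.mul_den_eq_num, ← Int.cast_natCast, Int.natAbs_of_nonneg
    (Rat.num_nonneg.2 hy.le)]

theorem secondDerivAtOne_inv {y : ℚ} (hy : 0 < y) :
    secondDerivAtOne y⁻¹ = (y ^ 2 - y + 1 - 1 / y.den ^ 2) ^ 2 / (2 * y ^ 3)
      - ((y ^ 2 - y + 1 - 1 / y.den ^ 2) + secondDerivAtOne y) / y ^ 2 := by
  obtain ⟨a, ha⟩ := Int.eq_ofNat_of_zero_le (Rat.num_nonneg.2 hy.le)
  set b := y.den with hb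
  have hb0 : 0 < b := y.den_pos
  have ha0 : 0 < a := by
    have := Rat.num_pos.2 hy
    omega
  have hab : Nat.Coprime a b := by
    have := y.reduced
    rwa [ha, Int.natAbs_natCast] at this
  have hy' : y = (a : ℚ) / b := by
    rw [← Rat.num_div_den y, ha, Int.cast_natCast]
  have hyi : y⁻¹ = ((b : ℤ) : ℚ) / ((a : ℤ) : ℚ) := by
    rw [hy', inv_div, Int.cast_natCast, Int.cast_natCast]
  have hnum : (y⁻¹).num = b := by
    rw [hyi]; exact Rat.num_div_eq_of_coprime (by exact_mod_cast ha0) (by simpa using hab.symm)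
  have hden : ((y⁻¹).den : ℤ) = a := by
    rw [hyi]; exact Rat.den_div_eq_of_coprime (by exact_mod_cast ha0) (by simpa using hab.symm)
  have hden' : (y⁻¹).den = a := by exact_mod_cast hden
  have hrec := genDedekindSum_one_three_reciprocity ha0 hb0 hab
  have ha' : (a : ℝ) ≠ 0 := by positivity
  have hb' : (b : ℝ) ≠ 0 := by positivity
  have hs : genDedekindSum 1 3 b a = b ^ 2 * ((5 * a ^ 2 * b ^ 2 - a ^ 4 - b ^ 4 - 3) /
      (120 * a ^ 3 * b ^ 3 : ℝ) - genDedekindSum 1 3 a b / a ^ 2) := by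
    rw [← hrec]; field_simp; ring
  rw [secondDerivAtOne, secondDerivAtOne, hnum, hden', ← hb, ha, hs, hy', polyF, polyF, polyG,
    polyG]
  push_cast
  field_simp
  ring

theorem QRationalJet.inv {y : ℚ} (hy : 1 < y) (h : QRationalJet y) : QRationalJet y⁻¹ := by
  obtain ⟨c, hc, h⟩ := h
  have hy0 : 0 < y := by linarith
  have hy' : (y : ℝ) ≠ 0 := by exact_mod_cast hy0.ne'
  set A := (y ^ 2 - y + 1 - 1 / (y.den : ℚ) ^ 2) / 2 with hA
  refine ⟨A ^ 2 / y ^ 3 - (A + c) / y ^ 2, ?_, fun q hq ↦ ?_⟩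
  · rw [secondDerivAtOne_inv hy0, ← hc, hA]
    push_cast
    field_simp
  · have := (h q⁻¹ hq.inv).inv hq hy0.ne'
    rw [← qContFrac_inv q hy] at this
    convert this using 1
    · rw [one_div]
    · have hd := y.den_ne_zero
      rw [den_inv_eq_mul_den hy0, hA]
      field_simp
      ring

/-- A Euclidean descent: the inverse of a nonzero fractional part has a smaller denominator and
exceeds `1`, so inversion followed by integer shifts reaches `x`. -/
theorem qRationalJet (x : ℚ) : QRationalJet x := by
  induction hn : x.den using Nat.strong_induction_on generalizing x with
  | _ n ih =>
    have key : QRationalJet (Int.fract x) := by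
      rcases eq_or_ne (Int.fract x) 0 with h | h
      · rw [h]; exact qRationalJet_zero
      · have h0 : 0 < Int.fract x := lt_of_le_of_ne (Int.fract_nonneg x) h.symm
        have := (ih _ (hn ▸ den_inv_fract_lt x h) (Int.fract x)⁻¹ rfl).inv
          ((one_lt_inv₀ h0).2 (Int.fract_lt_one x))
        rwa [inv_inv] at this
    have shift : ∀ k : ℤ, QRationalJet (Int.fract x + k) := by
      intro k
      induction k using Int.induction_on with
      | zero => simpa using key
      | succ k ih' =>
        have := (qRationalJet_add_one_iff _).2 ih'
        push_cast at this ⊢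
        rwa [← add_assoc]
      | pred k ih' =>
        refine (qRationalJet_add_one_iff _).1 ?_
        push_cast at ih' ⊢
        rwa [add_assoc, sub_add_cancel]
    have := shift ⌊x⌋
    rwa [Int.fract_add_floor] at this

/-! ### From jets to derivatives, and the theorem -/

open Filter Topology in
theorem HasJet.iteratedDeriv_two {r : RatFunc ℚ} {c₀ c₁ c₂ : ℚ} (h : HasJet RatFunc.X r c₀ c₁ c₂) :
    iteratedDeriv 2 (fun q : ℝ ↦ r.eval (algebraMap ℚ ℝ) q) 1 = 2 * (c₂ : ℝ) := by
  obtain ⟨e, he, hr⟩ := h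
  set g : ℝ → ℝ := fun q ↦ e.eval (algebraMap ℚ ℝ) q with hg
  set P : Polynomial ℚ := Polynomial.C c₀ + Polynomial.C c₁ * (Polynomial.X - 1)
    + Polynomial.C c₂ * (Polynomial.X - 1) ^ 2 with hP
  set Q : Polynomial ℚ := (Polynomial.X - 1) ^ 3 with hQ
  have hr' : r = algebraMap _ _ P + algebraMap _ _ Q * e := by
    rw [hr, hP, hQ]
    simp
  have hden : Polynomial.eval₂ (algebraMap ℚ ℝ) 1 e.denom ≠ 0 := by
    rw [← map_one (algebraMap ℚ ℝ), Polynomial.eval₂_at_apply]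
    simpa using mem_regularAtOne.1 he
  have hgs : ContDiffAt ℝ 2 g 1 := by
    have hpoly : ∀ p : Polynomial ℚ, ContDiffAt ℝ 2 (fun q : ℝ ↦ p.eval₂ (algebraMap ℚ ℝ) q) 1 := by
      intro p
      exact (p.contDiff_aeval (𝕜 := ℝ) 2).contDiffAt
    exact (hpoly _).div (hpoly _) hden
  have hcont : Continuous (fun q : ℝ ↦ Polynomial.eval₂ (algebraMap ℚ ℝ) q e.denom) := by
    simp_rw [← Polynomial.eval_map]
    exact Polynomial.continuous _
  -- Evaluation respects sums and products only where the denominators do not vanish, so the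
  -- identity is asserted near `1`, which is enough for derivatives at `1`.
  have hev : (fun q : ℝ ↦ r.eval (algebraMap ℚ ℝ) q) =ᶠ[𝓝 1]
      fun q ↦ c₀ + c₁ * (q - 1) + c₂ * (q - 1) ^ 2 + (q - 1) ^ 3 * g q := by
    filter_upwards [hcont.continuousAt.eventually_ne hden] with q hq
    have hd1 : ∀ p : Polynomial ℚ, Polynomial.eval₂ (algebraMap ℚ ℝ) q
        (algebraMap (Polynomial ℚ) (RatFunc ℚ) p).denom ≠ 0 := by
      intro p; simp
    have hd2 : Polynomial.eval₂ (algebraMap ℚ ℝ) q (algebraMap _ (RatFunc ℚ) Q * e).denom ≠ 0 := by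
      intro h0
      have := Polynomial.eval₂_eq_zero_of_dvd_of_eval₂_eq_zero (algebraMap ℚ ℝ) q
        (RatFunc.denom_mul_dvd (algebraMap _ (RatFunc ℚ) Q) e) h0
      rw [Polynomial.eval₂_mul] at this
      exact mul_ne_zero (hd1 Q) hq this
    rw [hr', RatFunc.eval_add (algebraMap ℚ ℝ) q (hd1 P) hd2, RatFunc.eval_mul (algebraMap ℚ ℝ) q (hd1 Q) hq,
      RatFunc.eval_algebraMap,
      RatFunc.eval_algebraMap, hP, hQ]
    simp [hg, Polynomial.eval₂_add, Polynomial.eval₂_mul, Polynomial.eval₂_pow, Polynomial.eval₂_sub]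
  rw [hev.iteratedDeriv_eq, iteratedDeriv_succ, iteratedDeriv_one]
  have hg1 : ∀ᶠ q in 𝓝 (1 : ℝ), DifferentiableAt ℝ g q :=
    (hgs.eventually (by simp)).mono fun q hq ↦ hq.differentiableAt (by simp)
  have hderiv : deriv (fun q ↦ (c₀ : ℝ) + c₁ * (q - 1) + c₂ * (q - 1) ^ 2 + (q - 1) ^ 3 * g q)
      =ᶠ[𝓝 1] fun q ↦ c₁ + 2 * c₂ * (q - 1) + (3 * (q - 1) ^ 2 * g q + (q - 1) ^ 3 * deriv g q) := by
    filter_upwards [hg1] with q hq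
    have h1 : HasDerivAt (fun q : ℝ ↦ q - 1) 1 q := (hasDerivAt_id q).sub_const 1
    have := (((h1.const_mul (c₁ : ℝ)).const_add (c₀ : ℝ)).add ((h1.pow 2).const_mul (c₂ : ℝ))).add
      ((h1.pow 3).mul hq.hasDerivAt)
    refine (this.congr_deriv ?_).deriv
    simp
    ring
  rw [hderiv.deriv_eq]
  have hg2 : DifferentiableAt ℝ (deriv g) 1 := by
    have : ContDiffAt ℝ 1 (deriv g) 1 := by
      have := (hgs.fderiv_right (m := 1) (by norm_num)).clm_apply
        (contDiffAt_const (c := (1 : ℝ)))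
      simpa only [fderiv_apply_one_eq_deriv] using this
    exact this.differentiableAt (by simp)
  have h1 : HasDerivAt (fun q : ℝ ↦ q - 1) 1 1 := (hasDerivAt_id 1).sub_const 1
  have := ((h1.const_mul (2 * c₂ : ℝ)).const_add (c₁ : ℝ)).add
    ((((h1.pow 2).const_mul (3 : ℝ)).mul hg1.self_of_nhds.hasDerivAt).add
      ((h1.pow 3).mul hg2.hasDerivAt))
  refine (this.congr_deriv ?_).deriv
  simp

theorem thomae_ratCast (x : ℚ) : thomae (x : ℝ) = 1 / x.den := by
  have h : ∃ r : ℚ, (r : ℝ) = x := ⟨x, rfl⟩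
  have hx : h.choose = x := by exact_mod_cast h.choose_spec
  rw [thomae, dif_pos h, hx]

theorem theorem1p2 (a : ℤ) (b : ℕ) (hb : 0 < b) (hab : IsCoprime a (b : ℤ)) :
    -- the rational function `[a/b]_q` has no pole at `q = 1`
    (qRational ((a : ℚ) / (b : ℚ))).denom.eval 1 ≠ 0 ∧
    -- its second derivative at `q = 1`
    iteratedDeriv 2 (qRationalFun ((a : ℚ) / (b : ℚ))) 1 =
      polyF ((a : ℝ) / (b : ℝ))
        + thomae ((a : ℝ) / (b : ℝ)) ^ 2 * polyG ((a : ℝ) / (b : ℝ))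
        + 20 * ∑ n ∈ Finset.Ico 1 b, angleBracket n a b * polyH ((n : ℝ) / (b : ℝ)) ∧
    -- the sum term in terms of a generalized Dedekind sum
    20 * ∑ n ∈ Finset.Ico 1 b, angleBracket n a b * polyH ((n : ℝ) / (b : ℝ)) =
      -20 * genDedekindSum 1 3 a b := by
  have hsum := sum_angleBracket_mul_polyH a hb hab
  obtain ⟨c, hc, hjet⟩ := qRationalJet ((a : ℚ) / b)
  have hjet := hjet _ isParameterAtOne_X
  have hcop : Nat.Coprime a.natAbs (b : ℤ).natAbs := Int.isCoprime_iff_gcd_eq_one.1 hab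
  have hb' : (0 : ℤ) < b := by exact_mod_cast hb
  have hnum : ((a : ℚ) / b).num = a := by
    simpa using Rat.num_div_eq_of_coprime hb' hcop
  have hden : ((a : ℚ) / b).den = b := by
    have := Rat.den_div_eq_of_coprime hb' hcop
    rw [Int.cast_natCast] at this
    exact_mod_cast this
  refine ⟨?_, ?_, by rw [hsum]; ring⟩
  · rw [← mem_regularAtOne]
    obtain ⟨e, he, hr⟩ := hjet
    have hX : (RatFunc.X - 1 : RatFunc ℚ) ∈ regularAtOne :=
      sub_mem X_mem_regularAtOne (one_mem _)
    have hC := ratCast_mem_regularAtOne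
    rw [qRational, hr]
    exact add_mem (add_mem (add_mem (hC _) (mul_mem (hC _) hX)) (mul_mem (hC _) (pow_mem hX _)))
      (mul_mem (pow_mem hX _) he)
  · have h := hjet.iteratedDeriv_two
    have hth := thomae_ratCast ((a : ℚ) / b)
    rw [hden] at hth
    push_cast at hth
    rw [hc, secondDerivAtOne, hnum, hden] at h
    push_cast at h
    rw [hsum, hth]
    unfold qRationalFun qRational
    rw [h]
    ring
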